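/- \textbf{Setting.} Let $N\ge 1$ and let $J:\mathbb{R}^N\to\mathbb{R}$ be continuous, nonnegative, radially symmetric and compactly supported, with $\int_{\mathbb{R}^N}J=1$ and $\operatorname{supp}J=\overline{B}_{R_J}$, the closed ball of radius $R_J$ centred at $0$. Put $\Gamma(s)=\operatorname{sign}(s)\,(|s|-1)_+$. For $f\in L^1(\mathbb{R}^N)$, an $L^1$-solution of $$u_t=J*\Gamma(u)-\Gamma(u),\qquad u(0)=f \qquad (1)$$ is a function $u\in C([0,\infty);L^1(\mathbb{R}^N))$ such that $u(t)=f+\int_0^t\big(J*\Gamma(u(s))-\Gamma(u(s))\big)\,ds$ in $L^1(\mathbb{R}^N)$ for all $t\ge0$. Replacing $\Gamma(s)$ by $(s-1)_+$ gives the one-phase Stefan problem. Write $f_+=\max(f,0)$ and $f_-=\max(-f,0)$. For $0\le h\in L^1(\mathbb{R}^N)$, the nonlocal obstacle problem at level one is to find $0\le w\in L^1(\mathbb{R}^N)$ such that, a.e. in $\mathbb{R}^N$, $$0\le h+J*w-w\le 1,\qquad (h+J*w-w-1)\,w=0 .$$ If it has a unique solution $w$, put $\mathcal{P}h:=h+J*w-w$.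 For $g\in L^1(\mathbb{R}^N)$, $\operatorname{supp}(g)$ denotes the distributional support of $g$, i.e. the complement of the largest open set on which the distribution $g$ vanishes, and $\operatorname{dist}(A,B)=\inf\{|x-y|: x\in A,\ y\in B\}$, with $\inf\emptyset=+\infty$. \textbf{Theorem.} Let $f\in L^1(\mathbb{R}^N)$. If $N=1$ or $N=2$, assume moreover that $J$ is nonincreasing in the radial variable and that $f_+\le g_1$ and $f_-\le g_2$ a.e. for some $g_1,g_2\in L^1(\mathbb{R}^N)$ that are continuous, tend to $0$ at infinity, and are radial and strictly decreasing in the radial variable. Then the obstacle problems with data $f_+$ and $f_-$ are uniquely solvable, so that $\mathcal{P}f_+$ and $\mathcal{P}f_-$ are defined. Assume that $$\operatorname{dist}\big(\operatorname{supp}(\mathcal{P}f_+),\operatorname{supp}(\mathcal{P}f_-)\big)>2R_J .$$ Then (1) has $L^1$-solutions $u$, $\mathbb{U}^+$, $\mathbb{U}^-$ with initial data $f$, $f_+$, $f_-$ respectively, and any such solutions have the following properties: $\mathbb{U}^+$ and $\mathbb{U}^-$ solve the one-phase Stefan problem with initial data $f_+$ and $f_-$; for every $t\ge0$, $$u(t)=\mathbb{U}^+(t)-\mathbb{U}^-(t)\quad\text{a.e.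 in }\mathbb{R}^N;$$ and, as $t\to\infty$, $\mathbb{U}^\pm(t)\to\mathcal{P}f_\pm$ and $$u(t)\to u_\infty=\mathcal{P}f_+-\mathcal{P}f_-\quad\text{in }L^1(\mathbb{R}^N).$$ -/

import Mathlib

open MeasureTheory Filter Topology
open scoped ENNReal NNReal Distributions

noncomputable section

namespace NonlocalStefan

/-- The Euclidean space `ℝ^N`. -/
abbrev Space (N : ℕ) : Type := EuclideanSpace ℝ (Fin N)

/-- The Banach space `L¹(ℝ^N)` (Lebesgue measure). -/
abbrev LOne (N : ℕ) : Type := Lp ℝ 1 (volume : Measure (Space N))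

/-- Convolution kernels: continuous, nonnegative, radially symmetric, compactly supported, with unit
mass; `radius` is the number `R_J` such that the support of `J` is the (closed) ball of radius `R_J`
centred at zero. -/
structure Kernel (N : ℕ) where
  toFun : Space N → ℝ
  radius : ℝ
  continuous_toFun : Continuous toFun
  nonneg : ∀ x, 0 ≤ toFun x
  radial : ∀ x y, ‖x‖ = ‖y‖ → toFun x = toFun y
  tsupport_eq : tsupport toFun = Metric.closedBall 0 radius
  integral_eq_one : ∫ x, toFun x = 1

theorem Kernel.integrable {N : ℕ} (J : Kernel N) : Integrable J.toFun volume :=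
  J.continuous_toFun.integrable_of_hasCompactSupport (by
    rw [HasCompactSupport, J.tsupport_eq]; exact isCompact_closedBall _ _)

/-- The convolution `J ∗ g`, as a map from `L¹` to `L¹`. -/
def conv {N : ℕ} (J : Kernel N) (g : LOne N) : LOne N :=
  (J.integrable.integrable_convolution (ContinuousLinearMap.lsmul ℝ ℝ)
    (L1.integrable_coeFn g)).toL1
      (convolution J.toFun g (ContinuousLinearMap.lsmul ℝ ℝ) volume)

/-- The two-phase graph `Γ(s) = sign(s) (|s| - 1)₊`. -/
def twoPhaseGraph (s : ℝ) : ℝ := Real.sign s * max (|s| - 1) 0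

/-- The one-phase graph `(s - 1)₊`. -/
def onePhaseGraph (s : ℝ) : ℝ := max (s - 1) 0

theorem twoPhaseGraph_eq (s : ℝ) : twoPhaseGraph s = max (s - 1) 0 - max (-s - 1) 0 := by
  unfold twoPhaseGraph
  rcases lt_trichotomy s 0 with h | h | h
  · rw [Real.sign_of_neg h, abs_of_neg h, max_eq_right (a := s - 1) (by linarith)]
    ring
  · subst h
    simp
  · rw [Real.sign_of_pos h, abs_of_pos h, max_eq_right (a := -s - 1) (by linarith)]
    ring

theorem lipschitzWith_twoPhaseGraph : LipschitzWith 1 twoPhaseGraph := by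
  refine LipschitzWith.of_dist_le_mul fun s t => ?_
  rw [NNReal.coe_one, one_mul, Real.dist_eq, Real.dist_eq, twoPhaseGraph_eq, twoPhaseGraph_eq]
  grind

theorem lipschitzWith_onePhaseGraph : LipschitzWith 1 onePhaseGraph := by
  refine LipschitzWith.of_dist_le_mul fun s t => ?_
  rw [NNReal.coe_one, one_mul, Real.dist_eq, Real.dist_eq, onePhaseGraph, onePhaseGraph]
  grind

theorem twoPhaseGraph_zero : twoPhaseGraph 0 = 0 := by simp [twoPhaseGraph]

theorem onePhaseGraph_zero : onePhaseGraph 0 = 0 := by simp [onePhaseGraph]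

/-- `u ∈ C([0,∞); L¹)` solves `u(t) = f + ∫₀ᵗ (J ∗ G(u(s)) - G(u(s))) ds` in `L¹` for all `t ≥ 0`.
Here `G` is a Lipschitz graph with `G 0 = 0`, so that it acts on `L¹` by composition. Only the
values of `u` on `[0,∞)` matter. -/
def IsSolution {N : ℕ} (J : Kernel N) {G : ℝ → ℝ} (hG : LipschitzWith 1 G) (hG0 : G 0 = 0)
    (f : LOne N) (u : ℝ → LOne N) : Prop :=
  ContinuousOn u (Set.Ici 0) ∧
    ∀ t : ℝ, 0 ≤ t →
      u t = f + ∫ s in (0 : ℝ)..t, (conv J (hG.compLp hG0 (u s)) - hG.compLp hG0 (u s))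

/-- `u` is the `L¹`-solution of the two-phase problem `u_t = J ∗ Γ(u) - Γ(u)`, `u(0) = f`. -/
def IsTwoPhaseSolution {N : ℕ} (J : Kernel N) (f : LOne N) (u : ℝ → LOne N) : Prop :=
  IsSolution J lipschitzWith_twoPhaseGraph twoPhaseGraph_zero f u

/-- `u` is the `L¹`-solution of the one-phase problem `u_t = J ∗ (u - 1)₊ - (u - 1)₊`,
`u(0) = f`. -/
def IsOnePhaseSolution {N : ℕ} (J : Kernel N) (f : LOne N) (u : ℝ → LOne N) : Prop :=
  IsSolution J lipschitzWith_onePhaseGraph onePhaseGraph_zero f u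

/-- The nonlocal obstacle problem at level one with data `f`: `w ∈ L¹`, `w ≥ 0`,
`0 ≤ f + J ∗ w - w ≤ 1` and `(f + J ∗ w - w - 1) w = 0` almost everywhere. -/
def IsObstacleSolution {N : ℕ} (J : Kernel N) (f w : LOne N) : Prop :=
  (∀ᵐ x, 0 ≤ w x) ∧
    (∀ᵐ x, 0 ≤ (f + conv J w - w : LOne N) x ∧ (f + conv J w - w : LOne N) x ≤ 1) ∧
    (∀ᵐ x, ((f + conv J w - w : LOne N) x - 1) * w x = 0)

open Classical in
/-- The projection `P f = f + J ∗ w - w`, where `w` is the solution of the obstacle problem with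
data `f` (with the value `0` if there is none). -/
def proj {N : ℕ} (J : Kernel N) (f : LOne N) : LOne N :=
  if h : ∃ w, IsObstacleSolution J f w then f + conv J h.choose - h.choose else 0

/-- The distributional support of an integrable function: the complement of the largest open set on
which the distribution `φ ↦ ∫ g φ` vanishes. -/
def distSupport {N : ℕ} (g : LOne N) : Set (Space N) :=
  Distribution.dsupport fun φ : 𝓓((⊤ : TopologicalSpace.Opens (Space N)), ℝ) => ∫ x, g x * φ x

/-- The distance between two sets, `inf {|x - y| : x ∈ A, y ∈ B}`; it is `∞` if one is empty. -/
def setDist {N : ℕ} (A B : Set (Space N)) : ℝ≥0∞ := ⨅ x ∈ A, ⨅ y ∈ B, edist x y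

/-- `J` is non-increasing in the radial variable. -/
def Kernel.RadiallyNonincreasing {N : ℕ} (J : Kernel N) : Prop :=
  ∀ x y, ‖x‖ ≤ ‖y‖ → J.toFun y ≤ J.toFun x

/-- `g ∈ L¹ ∩ C₀`, radial and strictly decreasing in the radial variable. -/
structure IsRadialMajorant {N : ℕ} (g : Space N → ℝ) : Prop where
  integrable : Integrable g volume
  continuous : Continuous g
  tendsto_zero : Tendsto g (cocompact (Space N)) (𝓝 0)
  radial : ∀ x y, ‖x‖ = ‖y‖ → g x = g y
  strictAnti : ∀ x y, ‖x‖ < ‖y‖ → g y < g x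

end NonlocalStefan

end

open NonlocalStefan

/-! For nonnegative data the one-phase flow is understood through the Baiocchi variable `w(t) = ∫₀ᵗ
(u(s) - 1)₊ ds`. Integrating the equation in time gives `u(t) = f + J ∗ w(t) - w(t)`, which has the
form of the obstacle problem. The truncation `min(u(t), 1)` is nondecreasing in `t`
(`sub_excess_le`), so `w(t)` vanishes wherever `u(t) < 1`. Conservation of mass then bounds the
measure of `{w(t) ≠ 0}` by `∫ f`.

The quantitative core is `exists_norm_le_of_le_conv_add`. If `0 ≤ w ≤ J ∗ w + h` with `h ≥ 0` and
`w` lives on a set of measure at most `M`, then `‖w‖ ≤ C ‖h‖`: a high convolution power of `J`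
pushes a fixed fraction of the mass off any such set. With `h = f` it bounds `w(t)` uniformly in
time. A bounded monotone family in `L¹` converges, and the limit of `w(t)` solves the obstacle
problem, hence `u(t) → P f`. With `h = 0` it gives uniqueness for the obstacle problem.

For the two-phase problem, `min(U±(t), 1) ≤ P f±` by monotonicity, so each `U±(t)` vanishes almost
everywhere off the support of its limit. These supports are disjoint, so at almost every point at
most one of `U⁺(t)`, `U⁻(t)` is nonzero and `Γ(U⁺ - U⁻) = (U⁺ - 1)₊ - (U⁻ - 1)₊`. The difference `U⁺
- U⁻` therefore solves the two-phase problem with data `f`, and uniqueness for Lipschitz equations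
in `L¹` identifies it with `u`. -/

noncomputable section

namespace NonlocalStefan

variable {N : ℕ}

/-! ### Convolution with `J` as a positive, mass-preserving contraction of `L¹` -/

/-- Convolution of real functions on `ℝ^N`. -/
abbrev realConv (f g : Space N → ℝ) : Space N → ℝ :=
  convolution f g (ContinuousLinearMap.lsmul ℝ ℝ) volume

theorem Kernel.hasCompactSupport (J : Kernel N) : HasCompactSupport J.toFun := by
  rw [HasCompactSupport, J.tsupport_eq]; exact isCompact_closedBall _ _

theorem LOne.integrable (g : LOne N) : Integrable g volume := L1.integrable_coeFn g

theorem coeFn_conv (J : Kernel N) (g : LOne N) : conv J g =ᵐ[volume] realConv J.toFun g :=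
  Integrable.coeFn_toL1 _

theorem convolutionExists_of_hasCompactSupport {f g : Space N → ℝ} (hf : Continuous f)
    (hfc : HasCompactSupport f) (hg : Integrable g) :
    ConvolutionExists f g (ContinuousLinearMap.lsmul ℝ ℝ) volume :=
  hfc.convolutionExists_left _ hf hg.locallyIntegrable

theorem realConv_congr {f g g' : Space N → ℝ} (h : g =ᵐ[volume] g') :
    realConv f g = realConv f g' :=
  convolution_congr _ (EventuallyEq.refl _ _) h

theorem realConv_nonneg {f g : Space N → ℝ} (hf : ∀ x, 0 ≤ f x) (hg : 0 ≤ᵐ[volume] g)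
    (x : Space N) : 0 ≤ realConv f g x := by
  -- Changing `g` on a null set leaves the convolution unchanged at every point, so the conclusion
  -- holds everywhere.
  have h : g =ᵐ[volume] fun x => max (g x) 0 := by
    filter_upwards [hg] with x hx
    exact (max_eq_left hx).symm
  rw [realConv_congr h]
  exact integral_nonneg fun t => mul_nonneg (hf t) (le_max_right _ _)

theorem conv_add (J : Kernel N) (g h : LOne N) : conv J (g + h) = conv J g + conv J h := by
  refine Lp.ext ?_
  have e := (convolutionExists_of_hasCompactSupport J.continuous_toFun J.hasCompactSupport
    g.integrable).distrib_add (convolutionExists_of_hasCompactSupport J.continuous_toFun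
      J.hasCompactSupport h.integrable)
  filter_upwards [coeFn_conv J (g + h), coeFn_conv J g, coeFn_conv J h,
    Lp.coeFn_add (conv J g) (conv J h)] with x h1 h2 h3 h4
  rw [h1, h4, Pi.add_apply, h2, h3, realConv_congr (Lp.coeFn_add g h)]
  exact congrFun e x

theorem conv_smul (J : Kernel N) (c : ℝ) (g : LOne N) : conv J (c • g) = c • conv J g := by
  refine Lp.ext ?_
  filter_upwards [coeFn_conv J (c • g), coeFn_conv J g, Lp.coeFn_smul c (conv J g)] with x h1 h2 h3
  rw [h1, h3, Pi.smul_apply, h2, realConv_congr (Lp.coeFn_smul c g), realConv, convolution_smul]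
  rfl

theorem conv_nonneg (J : Kernel N) {g : LOne N} (hg : 0 ≤ g) : 0 ≤ conv J g := by
  rw [← Lp.coeFn_nonneg] at hg ⊢
  filter_upwards [coeFn_conv J g] with x h1
  rw [h1]
  exact realConv_nonneg J.nonneg hg x

theorem integral_conv (J : Kernel N) (g : LOne N) : ∫ x, conv J g x = ∫ x, g x := by
  rw [integral_congr_ae (coeFn_conv J g),
    integral_convolution _ J.integrable g.integrable, J.integral_eq_one]
  simp

theorem norm_eq_integral {g : LOne N} (hg : 0 ≤ g) : ‖g‖ = ∫ x, g x := by
  rw [L1.norm_eq_integral_norm]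
  refine integral_congr_ae ?_
  filter_upwards [(Lp.coeFn_nonneg g).2 hg] with x hx
  exact Real.norm_of_nonneg hx

theorem norm_conv_of_nonneg (J : Kernel N) {g : LOne N} (hg : 0 ≤ g) : ‖conv J g‖ = ‖g‖ := by
  rw [norm_eq_integral hg, norm_eq_integral (conv_nonneg J hg), integral_conv]

/-- Convolution with a kernel, as a linear map of `L¹`. -/
def convLinear (J : Kernel N) : LOne N →ₗ[ℝ] LOne N where
  toFun := conv J
  map_add' := conv_add J
  map_smul' := conv_smul J

theorem conv_mono (J : Kernel N) {g h : LOne N} (hgh : g ≤ h) : conv J g ≤ conv J h := by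
  have := conv_nonneg J (sub_nonneg.2 hgh)
  rwa [show conv J (h - g) = conv J h - conv J g from (convLinear J).map_sub h g,
    sub_nonneg] at this

theorem norm_conv_le (J : Kernel N) (g : LOne N) : ‖conv J g‖ ≤ ‖g‖ := by
  have h : |conv J g| ≤ conv J |g| := by
    refine abs_le'.2 ⟨conv_mono J (le_abs_self g), ?_⟩
    rw [show -conv J g = conv J (-g) from ((convLinear J).map_neg g).symm]
    exact conv_mono J (neg_le_abs g)
  calc ‖conv J g‖ ≤ ‖conv J |g|‖ := norm_le_norm_of_abs_le_abs (h.trans (le_abs_self _))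
    _ = ‖g‖ := by rw [norm_conv_of_nonneg J (abs_nonneg g), norm_abs_eq_norm]

/-- Convolution with a kernel, as a bounded operator on `L¹`. -/
def convCLM (J : Kernel N) : LOne N →L[ℝ] LOne N :=
  (convLinear J).mkContinuous 1 fun g => by rw [one_mul]; exact norm_conv_le J g

@[simp] theorem convCLM_apply (J : Kernel N) (g : LOne N) : convCLM J g = conv J g := rfl

/-! ### Convolution powers and the escape of mass from sets of bounded measure -/

/-- The convolution power `J ∗ ⋯ ∗ J` with `n + 1` factors. -/
def Kernel.convPow (J : Kernel N) : ℕ → Space N → ℝ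
  | 0 => J.toFun
  | n + 1 => realConv J.toFun (J.convPow n)

theorem Kernel.hasCompactSupport_convPow (J : Kernel N) (n : ℕ) :
    HasCompactSupport (J.convPow n) := by
  induction n with
  | zero => exact J.hasCompactSupport
  | succ n ih => exact J.hasCompactSupport.convolution _ ih

theorem Kernel.continuous_convPow (J : Kernel N) (n : ℕ) : Continuous (J.convPow n) := by
  induction n with
  | zero => exact J.continuous_toFun
  | succ n ih =>
    exact J.hasCompactSupport.continuous_convolution_left _ J.continuous_toFun
      (ih.integrable_of_hasCompactSupport (J.hasCompactSupport_convPow n)).locallyIntegrable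

theorem Kernel.integrable_convPow (J : Kernel N) (n : ℕ) : Integrable (J.convPow n) :=
  (J.continuous_convPow n).integrable_of_hasCompactSupport (J.hasCompactSupport_convPow n)

theorem Kernel.convPow_nonneg (J : Kernel N) (n : ℕ) (x : Space N) : 0 ≤ J.convPow n x := by
  induction n generalizing x with
  | zero => exact J.nonneg x
  | succ n ih => exact realConv_nonneg J.nonneg (Eventually.of_forall ih) x

theorem Kernel.exists_pos_on_ball (J : Kernel N) :
    ∃ x₀, ∃ r > 0, ∀ x ∈ Metric.ball x₀ r, 0 < J.toFun x := by
  have h : ∃ x₀, J.toFun x₀ ≠ 0 := by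
    by_contra! h
    have := J.integral_eq_one
    simp [h] at this
  obtain ⟨x₀, hx₀⟩ := h
  have hpos : 0 < J.toFun x₀ := lt_of_le_of_ne (J.nonneg _) hx₀.symm
  obtain ⟨r, hr, h⟩ := Metric.isOpen_iff.1 (isOpen_lt continuous_const J.continuous_toFun) x₀ hpos
  exact ⟨x₀, r, hr, fun x hx => h hx⟩

/-- Positivity sets add up under convolution: the `(n + 1)`-fold Minkowski sum of a ball is the ball
with centre and radius multiplied by `n + 1`. -/
theorem Kernel.convPow_pos (J : Kernel N) {x₀ : Space N} {r : ℝ}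
    (h : ∀ x ∈ Metric.ball x₀ r, 0 < J.toFun x) (n : ℕ) (x : Space N)
    (hx : ‖x - ((n : ℝ) + 1) • x₀‖ < ((n : ℝ) + 1) * r) : 0 < J.convPow n x := by
  induction n generalizing x with
  | zero => exact h x (by simpa [dist_eq_norm] using hx)
  | succ n ih =>
    push_cast at hx
    have hn : (0 : ℝ) < (n : ℝ) + 1 := by positivity
    set a : ℝ := (n : ℝ) + 1
    have ha : (0 : ℝ) < a + 1 := by positivity
    -- Split `x` as `t + a • t`: the first piece lies in the original ball, the second in its
    -- dilation by `a = n + 1`. The convolution integrand is therefore positive at `t`.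
    set t : Space N := (a + 1)⁻¹ • x with ht
    have hxt : x = (a + 1) • t := by rw [ht, smul_inv_smul₀ ha.ne']
    have htr : ‖t - x₀‖ < r := by
      rw [hxt, ← smul_sub, norm_smul, Real.norm_of_nonneg ha.le] at hx
      exact lt_of_mul_lt_mul_left hx ha.le
    have h1 : 0 < J.toFun t := h t (by rwa [Metric.mem_ball, dist_eq_norm])
    have h2 : 0 < J.convPow n (x - t) := by
      refine ih _ ?_
      rw [hxt, show (a + 1) • t - t - a • x₀ = a • (t - x₀) by module, norm_smul,
        Real.norm_of_nonneg hn.le]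
      exact mul_lt_mul_of_pos_left htr hn
    have hc : Continuous fun s => J.toFun s * J.convPow n (x - s) :=
      J.continuous_toFun.mul ((J.continuous_convPow n).comp (continuous_const.sub continuous_id))
    exact hc.integral_pos_of_hasCompactSupport_nonneg_nonzero J.hasCompactSupport.mul_right
      (fun s => mul_nonneg (J.nonneg s) (J.convPow_nonneg n _)) (mul_pos h1 h2).ne'

theorem coeFn_iterate_convCLM (J : Kernel N) (n : ℕ) (w : LOne N) :
    ((convCLM J)^[n + 1] w : LOne N) =ᵐ[volume] realConv (J.convPow n) w := by
  induction n with
  | zero => exact coeFn_conv J w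
  | succ n ih =>
    rw [Function.iterate_succ_apply']
    refine (coeFn_conv J _).trans (Eventually.of_forall fun x => ?_)
    rw [realConv_congr ih]
    refine (convolution_assoc _ _ _ _ (fun a b c => by simp [mul_assoc])
      J.continuous_toFun.aestronglyMeasurable (J.continuous_convPow n).aestronglyMeasurable
      (Lp.aestronglyMeasurable w) ?_ ?_ ?_).symm
    · exact Eventually.of_forall (convolutionExists_of_hasCompactSupport J.continuous_toFun
        J.hasCompactSupport (J.integrable_convPow n))
    · exact Eventually.of_forall (convolutionExists_of_hasCompactSupport
        (J.continuous_convPow n).norm (J.hasCompactSupport_convPow n).norm w.integrable.norm)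
    · exact convolutionExists_of_hasCompactSupport J.continuous_toFun.norm
        J.hasCompactSupport.norm (Integrable.integrable_convolution _
          (J.integrable_convPow n).norm w.integrable.norm) x

theorem exists_one_le_volume_closedBall (hN : 1 ≤ N) (M : ℝ) {r : ℝ} (hr : 0 < r) :
    ∃ n : ℕ, ∀ x : Space N,
      ENNReal.ofReal M ≤ volume (Metric.closedBall x (((n : ℝ) + 1) * r)) := by
  have hb : 0 < (volume (Metric.ball (0 : Space N) 1)).toReal :=
    ENNReal.toReal_pos (Metric.measure_ball_pos _ _ one_pos).ne' measure_ball_lt_top.ne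
  set b := (volume (Metric.ball (0 : Space N) 1)).toReal
  obtain ⟨n, hn⟩ := exists_nat_gt (max 1 (M / b) / r)
  have hn' : max 1 (M / b) ≤ ((n : ℝ) + 1) * r := by
    rw [div_lt_iff₀ hr] at hn
    nlinarith
  refine ⟨n, fun x => ?_⟩
  set R := ((n : ℝ) + 1) * r
  have h1 : 1 ≤ R := (le_max_left _ _).trans hn'
  have h2 : M ≤ R * b := (div_le_iff₀ hb).1 ((le_max_right _ _).trans hn')
  rw [Measure.addHaar_closedBall _ _ (by linarith), finrank_euclideanSpace_fin,
    ← ENNReal.ofReal_toReal (a := volume (Metric.ball (0 : Space N) 1)) measure_ball_lt_top.ne,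
    ← ENNReal.ofReal_mul (by positivity)]
  refine ENNReal.ofReal_le_ofReal (h2.trans ?_)
  exact mul_le_mul_of_nonneg_right (le_self_pow₀ h1 (by omega)) hb.le

/-- For large `n` the power is bounded below on a ball of volume at least `M + 1`. Wherever that
ball is translated, a set of measure at most `M` misses a portion of it of volume at least one. -/
theorem Kernel.exists_convPow_escape (hN : 1 ≤ N) (J : Kernel N) (M : ℝ) :
    ∃ n : ℕ, ∃ ε > 0, ∀ A : Set (Space N), volume A ≤ ENNReal.ofReal M → ∀ y,
      ENNReal.ofReal ε ≤ ∫⁻ x in Aᶜ, ENNReal.ofReal (J.convPow n (x - y)) := by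
  obtain ⟨x₀, r, hr, hJ⟩ := J.exists_pos_on_ball
  -- Half the radius keeps the closed ball inside the open positivity set, where the minimum over a
  -- compact set is positive. `max M 0` covers negative `M`.
  obtain ⟨n, hn⟩ := exists_one_le_volume_closedBall hN (max M 0 + 1) (half_pos hr)
  set C : Set (Space N) := Metric.closedBall (((n : ℝ) + 1) • x₀) (((n : ℝ) + 1) * (r / 2)) with hC
  have hCne : C.Nonempty := ⟨_, Metric.mem_closedBall_self (by positivity)⟩
  obtain ⟨z, hz, hmin⟩ := (isCompact_closedBall (((n : ℝ) + 1) • x₀)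
    (((n : ℝ) + 1) * (r / 2))).exists_isMinOn hCne (J.continuous_convPow n).continuousOn
  refine ⟨n, J.convPow n z, J.convPow_pos hJ n z ?_, fun A hA y => ?_⟩
  · rw [Metric.mem_closedBall, dist_eq_norm] at hz
    refine hz.trans_lt (mul_lt_mul_of_pos_left (half_lt_self hr) (by positivity))
  set C' : Set (Space N) :=
    Metric.closedBall (((n : ℝ) + 1) • x₀ + y) (((n : ℝ) + 1) * (r / 2)) with hC'
  have hmeas : MeasurableSet C' := Metric.isClosed_closedBall.measurableSet
  have hvol : 1 ≤ volume (C' ∩ Aᶜ) := by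
    have h1 : volume C' ≤ volume (C' ∩ Aᶜ) + volume A := by
      refine (measure_mono fun x hx => ?_).trans (measure_union_le _ _)
      by_cases hxA : x ∈ A
      · exact Or.inr hxA
      · exact Or.inl ⟨hx, hxA⟩
    have h2 := (hn (((n : ℝ) + 1) • x₀ + y)).trans h1
    rw [ENNReal.ofReal_add (le_max_right _ _) zero_le_one, add_comm, ENNReal.ofReal_one] at h2
    have h3 : volume A ≤ ENNReal.ofReal (max M 0) :=
      hA.trans (ENNReal.ofReal_le_ofReal (le_max_left _ _))
    exact (ENNReal.add_le_add_iff_right ENNReal.ofReal_ne_top).1 (h2.trans (by gcongr))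
  calc ENNReal.ofReal (J.convPow n z)
      ≤ ENNReal.ofReal (J.convPow n z) * volume (C' ∩ Aᶜ) := by
        simpa using mul_le_mul_right hvol (ENNReal.ofReal (J.convPow n z))
    _ = ∫⁻ x in C', ENNReal.ofReal (J.convPow n z) ∂(volume.restrict Aᶜ) := by
        rw [setLIntegral_const, Measure.restrict_apply hmeas]
    _ ≤ ∫⁻ x in C', ENNReal.ofReal (J.convPow n (x - y)) ∂(volume.restrict Aᶜ) := by
        refine setLIntegral_mono' hmeas fun x hx => ENNReal.ofReal_le_ofReal (hmin ?_)
        rw [hC', Metric.mem_closedBall, dist_eq_norm] at hx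
        show _ ∈ C
        rwa [hC, Metric.mem_closedBall, dist_eq_norm, sub_sub, add_comm y]
    _ ≤ _ := setLIntegral_le_lintegral _ _

/-- Tonelli: each unit of mass of `w` located at `y` contributes at least `ε` to the mass of `K ∗ w`
in `B`. -/
theorem setIntegral_realConv_ge {K w : Space N → ℝ} (hK : Continuous K)
    (hKc : HasCompactSupport K) (hK0 : ∀ x, 0 ≤ K x) (hw : Integrable w) (hw0 : 0 ≤ᵐ[volume] w)
    {B : Set (Space N)} {ε : ℝ} (hε : 0 ≤ ε)
    (h : ∀ y, ENNReal.ofReal ε ≤ ∫⁻ x in B, ENNReal.ofReal (K (x - y))) :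
    ε * ∫ x, w x ≤ ∫ x in B, realConv K w x := by
  have hint : Integrable (realConv K w) :=
    (hK.integrable_of_hasCompactSupport hKc).integrable_convolution _ hw
  have hnn := realConv_nonneg hK0 hw0
  rw [← ENNReal.ofReal_le_ofReal_iff (integral_nonneg hnn), ENNReal.ofReal_mul hε,
    ofReal_integral_eq_lintegral_ofReal hint.restrict (Eventually.of_forall hnn),
    ofReal_integral_eq_lintegral_ofReal hw hw0]
  have hpt (x : Space N) : ENNReal.ofReal (realConv K w x) =
      ∫⁻ y, ENNReal.ofReal (K (x - y)) * ENNReal.ofReal (w y) := by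
    have hi := (convolutionExists_of_hasCompactSupport hK hKc hw x).integrable_swap
    simp only [ContinuousLinearMap.lsmul_apply, smul_eq_mul] at hi
    rw [realConv, convolution_lsmul_swap]
    simp only [smul_eq_mul]
    rw [ofReal_integral_eq_lintegral_ofReal hi]
    · simp_rw [ENNReal.ofReal_mul (hK0 _)]
    · filter_upwards [hw0] with y hy
      exact mul_nonneg (hK0 _) hy
  simp_rw [hpt]
  rw [lintegral_lintegral_swap]
  · rw [← lintegral_const_mul' _ _ ENNReal.ofReal_ne_top]
    refine lintegral_mono fun y => ?_
    rw [lintegral_mul_const' _ _ ENNReal.ofReal_ne_top]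
    exact mul_le_mul_left (h y) _
  · have hK' : Measurable fun p : Space N × Space N => ENNReal.ofReal (K (p.1 - p.2)) :=
      (hK.measurable.comp (measurable_fst.sub measurable_snd)).ennreal_ofReal
    exact hK'.aemeasurable.mul hw.aemeasurable.ennreal_ofReal.comp_snd

/-- Iterating the inequality gives `w ≤ W + s`, where `W` is the iterated convolution of `w` and
`‖s‖ ≤ (n + 1) ‖h‖`. Integrate over `A = {w ≠ 0}`: `W` has the same total mass as `w` but leaves at
least `ε ‖w‖` outside `A`, so `ε ‖w‖ ≤ (n + 1) ‖h‖`. -/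
theorem exists_norm_le_of_le_conv_add (hN : 1 ≤ N) (J : Kernel N) (M : ℝ) :
    ∃ C : ℝ, ∀ w h : LOne N, 0 ≤ w → 0 ≤ h → w ≤ conv J w + h →
      volume {x | w x ≠ 0} ≤ ENNReal.ofReal M → ‖w‖ ≤ C * ‖h‖ := by
  obtain ⟨n, ε, hε, hesc⟩ := J.exists_convPow_escape hN M
  refine ⟨((n : ℝ) + 1) / ε, fun w h hw hh hle hvol => ?_⟩
  have hiter (k : ℕ) : 0 ≤ (convCLM J)^[k] w ∧ ‖(convCLM J)^[k] w‖ = ‖w‖ ∧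
      ∃ s : LOne N, 0 ≤ s ∧ ‖s‖ ≤ k * ‖h‖ ∧ w ≤ (convCLM J)^[k] w + s := by
    induction k with
    | zero => exact ⟨hw, rfl, 0, le_rfl, by simp, by simp⟩
    | succ k ih =>
      obtain ⟨h1, h2, s, h3, h4, h5⟩ := ih
      rw [Function.iterate_succ_apply', convCLM_apply]
      refine ⟨conv_nonneg J h1, (norm_conv_of_nonneg J h1).trans h2, conv J s + h,
        add_nonneg (conv_nonneg J h3) hh, ?_, ?_⟩
      · refine (norm_add_le _ _).trans ?_
        have := norm_conv_le J s
        push_cast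
        linarith
      · refine hle.trans ?_
        have := conv_mono J h5
        rw [conv_add] at this
        rw [← add_assoc]
        gcongr
  obtain ⟨h1, h2, s, h3, h4, h5⟩ := hiter (n + 1)
  set W := (convCLM J)^[n + 1] w with hW
  set A : Set (Space N) := {x | w x ≠ 0} with hA
  have hAm : MeasurableSet A := by
    have := (Lp.stronglyMeasurable w).measurable (measurableSet_singleton (0 : ℝ)).compl
    exact this
  have hlow : ε * ∫ x, w x ≤ ∫ x in Aᶜ, W x := by
    rw [setIntegral_congr_ae (g := realConv (J.convPow n) w) hAm.compl
      ((coeFn_iterate_convCLM J n w).mono fun x hx _ => hx)]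
    exact setIntegral_realConv_ge (J.continuous_convPow n) (J.hasCompactSupport_convPow n)
      (J.convPow_nonneg n) w.integrable ((Lp.coeFn_nonneg w).2 hw) hε.le (hesc A hvol)
  have hup : ∫ x, w x ≤ (∫ x in A, W x) + ∫ x, s x := by
    have e1 : ∫ x, w x = ∫ x in A, w x := by
      rw [setIntegral_eq_integral_of_forall_compl_eq_zero]
      intro x hx
      simpa [hA] using hx
    rw [e1]
    calc ∫ x in A, w x ≤ ∫ x in A, (W x + s x) := by
          refine setIntegral_mono_ae w.integrable.integrableOn
            (W.integrable.add s.integrable).integrableOn ?_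
          filter_upwards [(Lp.coeFn_le _ _).2 h5, Lp.coeFn_add W s] with x hx hx'
          rwa [hx', Pi.add_apply] at hx
      _ = (∫ x in A, W x) + ∫ x in A, s x :=
          integral_add W.integrable.integrableOn s.integrable.integrableOn
      _ ≤ (∫ x in A, W x) + ∫ x, s x := by
          refine add_le_add_right ?_ _
          exact setIntegral_le_integral s.integrable ((Lp.coeFn_nonneg s).2 h3)
  have hsplit := integral_add_compl hAm W.integrable
  rw [← norm_eq_integral hw] at hlow hup
  rw [← norm_eq_integral h1, h2] at hsplit
  rw [← norm_eq_integral h3] at hup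
  push_cast at h4
  rw [div_mul_eq_mul_div, le_div_iff₀ hε]
  linarith

/-! ### Autonomous Lipschitz equations in a Banach space: existence, uniqueness, invariant convex
sets -/

section IntegralEquation

variable {E : Type*} [NormedAddCommGroup E] [NormedSpace ℝ E]

/-- `u ∈ C([0,∞); E)` solves the autonomous equation `u(t) = f + ∫₀ᵗ F(u(s)) ds` for `t ≥ 0`. -/
def IsIntegralSolution (F : E → E) (f : E) (u : ℝ → E) : Prop :=
  ContinuousOn u (Set.Ici 0) ∧ ∀ t : ℝ, 0 ≤ t → u t = f + ∫ s in (0 : ℝ)..t, F (u s)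

/-- The contraction estimate in the weighted norm `sup e^(-ct) ‖u(t)‖`: integrating `c e^(cs)`
yields at most `e^(cτ)`, which the weight cancels. -/
theorem norm_integral_le_of_exp_bound {g : ℝ → E} {c A : ℝ}
    (hA : 0 ≤ A) (hg : ∀ s, ‖g s‖ ≤ A * (c * Real.exp (c * s))) {τ : ℝ} (hτ : 0 ≤ τ) :
    ‖Real.exp (-(c * τ)) • ∫ s in (0 : ℝ)..τ, g s‖ ≤ A := by
  have h1 : ∫ s in (0 : ℝ)..τ, A * (c * Real.exp (c * s)) =
      A * Real.exp (c * τ) - A * Real.exp (c * 0) := by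
    refine intervalIntegral.integral_eq_sub_of_hasDerivAt
      (f := fun s => A * Real.exp (c * s)) (fun s _ => ?_)
      (Continuous.intervalIntegrable (by fun_prop) _ _)
    exact (((hasDerivAt_id s).const_mul c).exp.const_mul A).congr_deriv (by
      simp only [id_eq]; ring)
  have h2 : ‖∫ s in (0 : ℝ)..τ, g s‖ ≤ A * Real.exp (c * τ) := by
    refine (intervalIntegral.norm_integral_le_of_norm_le hτ
      (Eventually.of_forall fun s _ => hg s) (Continuous.intervalIntegrable (by fun_prop) _ _)).trans
      ?_
    rw [h1]
    simpa using hA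
  rw [norm_smul, Real.norm_of_nonneg (Real.exp_pos _).le]
  calc _ ≤ Real.exp (-(c * τ)) * (A * Real.exp (c * τ)) := by gcongr
    _ = A := by rw [mul_left_comm, ← Real.exp_add]; simp

theorem exists_isIntegralSolution [CompleteSpace E] {F : E → E} {K : ℝ≥0}
    (hF : LipschitzWith K F) (hF0 : F 0 = 0) (f : E) : ∃ u, IsIntegralSolution F f u := by
  -- Any exponent above `K` makes the Picard map a contraction on `[0, ∞)` at once; this one gives
  -- the ratio `K / (K + 1)`.
  set c : ℝ := K + 1 with hcdef
  have hc : 0 < c := by positivity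
  have hFn (x : E) : ‖F x‖ ≤ K * ‖x‖ := by simpa [hF0] using hF.norm_sub_le x 0
  have hFc := hF.continuous
  let G (z : ℝ → E) (s : ℝ) : E := F (Real.exp (c * s) • z s)
  have hG (z : BoundedContinuousFunction ℝ E) : Continuous (G z) := by
    have := z.continuous
    fun_prop
  have hGn (z : BoundedContinuousFunction ℝ E) (s : ℝ) :
      ‖G z s‖ ≤ (K / c * ‖z‖) * (c * Real.exp (c * s)) := by
    refine (hFn _).trans ?_
    rw [norm_smul, Real.norm_of_nonneg (Real.exp_pos _).le]
    have := z.norm_coe_le_norm s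
    calc (K : ℝ) * (Real.exp (c * s) * ‖z s‖) ≤ K * (Real.exp (c * s) * ‖z‖) := by gcongr
      _ = _ := by field_simp
  have hGd (z z' : BoundedContinuousFunction ℝ E) (s : ℝ) :
      ‖G z s - G z' s‖ ≤ (K / c * dist z z') * (c * Real.exp (c * s)) := by
    refine (hF.norm_sub_le _ _).trans ?_
    rw [← smul_sub, norm_smul, Real.norm_of_nonneg (Real.exp_pos _).le, ← dist_eq_norm]
    have := BoundedContinuousFunction.dist_coe_le_dist (f := z) (g := z') s
    calc (K : ℝ) * (Real.exp (c * s) * dist (z s) (z' s))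
        ≤ K * (Real.exp (c * s) * dist z z') := by gcongr
      _ = _ := by field_simp
  -- The Picard map for the rescaled unknown `z(t) = e^(-ct) u(t)`, frozen at its value at time `0`
  -- for negative times by `max t 0`.
  let Φ (z : BoundedContinuousFunction ℝ E) : BoundedContinuousFunction ℝ E :=
    BoundedContinuousFunction.ofNormedAddCommGroup
      (fun t => Real.exp (-(c * max t 0)) • (f + ∫ s in (0 : ℝ)..max t 0, G z s))
      (by
        have h := intervalIntegral.continuous_primitive (μ := volume)
          (fun a b => (hG z).intervalIntegrable a b) 0
        have h' : Continuous fun t : ℝ => ∫ s in (0 : ℝ)..max t 0, G z s :=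
          h.comp (continuous_id.max continuous_const)
        fun_prop)
      (‖f‖ + K / c * ‖z‖)
      (fun t => by
        rw [smul_add]
        refine (norm_add_le _ _).trans (add_le_add ?_ ?_)
        · rw [norm_smul, Real.norm_of_nonneg (Real.exp_pos _).le]
          refine mul_le_of_le_one_left (norm_nonneg _) (Real.exp_le_one_iff.2 ?_)
          have : 0 ≤ c * max t 0 := by positivity
          linarith
        · exact norm_integral_le_of_exp_bound (by positivity) (hGn z) (le_max_right _ _))
  have hΦ : ContractingWith (K / (K + 1)) Φ := by
    refine ⟨(div_lt_one (by positivity)).2 (lt_add_one K), LipschitzWith.of_dist_le_mul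
      fun z z' => ?_⟩
    rw [BoundedContinuousFunction.dist_le (by positivity)]
    intro t
    rw [dist_eq_norm]
    show ‖Real.exp (-(c * max t 0)) • (f + ∫ s in (0 : ℝ)..max t 0, G z s) -
      Real.exp (-(c * max t 0)) • (f + ∫ s in (0 : ℝ)..max t 0, G z' s)‖ ≤ _
    rw [← smul_sub, add_sub_add_left_eq_sub, ← intervalIntegral.integral_sub
      ((hG z).intervalIntegrable _ _) ((hG z').intervalIntegrable _ _)]
    push_cast
    exact norm_integral_le_of_exp_bound (by positivity) (hGd z z') (le_max_right _ _)
  set z := hΦ.fixedPoint Φ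
  have hz : Φ z = z := hΦ.fixedPoint_isFixedPt
  refine ⟨fun t => Real.exp (c * t) • z t, by have := z.continuous; fun_prop, fun t ht => ?_⟩
  have h1 : z t = Real.exp (-(c * max t 0)) • (f + ∫ s in (0 : ℝ)..max t 0, G z s) :=
    (DFunLike.congr_fun hz t).symm
  rw [max_eq_left ht] at h1
  show Real.exp (c * t) • z t = _
  rw [h1, smul_smul, ← Real.exp_add, add_neg_cancel, Real.exp_zero, one_smul]

namespace IsIntegralSolution

variable {F : E → E} {K : ℝ≥0} {f : E} {u u' : ℝ → E}

theorem apply_zero (hu : IsIntegralSolution F f u) : u 0 = f := by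
  simpa using hu.2 0 le_rfl

theorem continuousOn_comp (hu : IsIntegralSolution F f u) {G : E → E} (hG : Continuous G) :
    ContinuousOn (fun s => G (u s)) (Set.Ici 0) :=
  hG.comp_continuousOn hu.1

theorem intervalIntegrable_comp (hu : IsIntegralSolution F f u) {G : E → E} (hG : Continuous G)
    {a b : ℝ} (ha : 0 ≤ a) (hb : 0 ≤ b) : IntervalIntegrable (fun s => G (u s)) volume a b :=
  ((hu.continuousOn_comp hG).mono fun _ hx => (le_min ha hb).trans hx.1).intervalIntegrable

theorem hasDerivWithinAt [CompleteSpace E] (hu : IsIntegralSolution F f u) (hF : Continuous F)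
    {t : ℝ} (ht : 0 ≤ t) : HasDerivWithinAt u (F (u t)) (Set.Ici t) t := by
  have hc := hu.continuousOn_comp hF
  have h : HasDerivWithinAt (fun x => ∫ s in (0 : ℝ)..x, F (u s)) (F (u t)) (Set.Ici t) t := by
    refine intervalIntegral.integral_hasDerivWithinAt_right
      (hu.intervalIntegrable_comp hF le_rfl ht) (t := Set.Ioi t) ?_ ?_
    · refine ⟨Set.Ioi t, self_mem_nhdsWithin, ?_⟩
      exact (hc.mono fun x hx => ht.trans (le_of_lt hx)).aestronglyMeasurable measurableSet_Ioi
    · exact (hc t ht).mono fun x hx => ht.trans (le_of_lt hx)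
  exact (h.const_add f).congr (fun x hx => hu.2 x (ht.trans hx)) (hu.2 t ht)

theorem shift (hu : IsIntegralSolution F f u) (hF : Continuous F) {s : ℝ} (hs : 0 ≤ s) :
    IsIntegralSolution F (u s) fun t => u (s + t) := by
  refine ⟨hu.1.comp (by fun_prop) fun t (ht : 0 ≤ t) => add_nonneg hs ht, fun t ht => ?_⟩
  show u (s + t) = _
  rw [intervalIntegral.integral_comp_add_left (fun x => F (u x)) s, add_zero,
    hu.2 (s + t) (add_nonneg hs ht), hu.2 s hs, add_assoc,
    intervalIntegral.integral_add_adjacent_intervals (hu.intervalIntegrable_comp hF le_rfl hs)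
      (hu.intervalIntegrable_comp hF hs (add_nonneg hs ht))]

theorem eqOn [CompleteSpace E] (hF : LipschitzWith K F) (hu : IsIntegralSolution F f u)
    (hu' : IsIntegralSolution F f u') {t : ℝ} (ht : 0 ≤ t) : u t = u' t := by
  refine ODE_solution_unique_of_mem_Icc_right (v := fun _ => F) (s := fun _ => Set.univ) (K := K)
    (a := 0) (b := t) (fun _ _ => hF.lipschitzOnWith) (hu.1.mono fun x hx => hx.1)
    (fun x hx => hu.hasDerivWithinAt hF.continuous hx.1) (fun _ _ => trivial)
    (hu'.1.mono fun x hx => hx.1)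
    (fun x hx => hu'.hasDerivWithinAt hF.continuous hx.1) (fun _ _ => trivial) ?_ ⟨ht, le_rfl⟩
  rw [hu.apply_zero, hu'.apply_zero]

/-- A closed convex set that is mapped into itself by `x ↦ x + F x` is invariant under the flow
of `F`. -/
theorem mem_of_convex [CompleteSpace E] (hF : LipschitzWith K F) (hu : IsIntegralSolution F f u)
    {C : Set E} (hC : IsClosed C) (hconv : Convex ℝ C) (hmap : ∀ x ∈ C, x + F x ∈ C) (hf : f ∈ C)
    {t : ℝ} (ht : 0 ≤ t) : u t ∈ C := by
  have hne : C.Nonempty := ⟨f, hf⟩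
  rw [hC.mem_iff_infDist_zero hne]
  refine le_antisymm ?_ Metric.infDist_nonneg
  -- An Euler step of length `h ≤ 1` from a point `y` of `C` stays in `C`, being a convex
  -- combination of `y` and `y + F y`. Comparing with nearly closest points of `C` costs the
  -- Lipschitz factor `1 + h K`.
  have hstep (x : E) (h : ℝ) (h0 : 0 ≤ h) (h1 : h ≤ 1) :
      Metric.infDist (x + h • F x) C ≤ (1 + h * K) * Metric.infDist x C := by
    refine le_of_forall_pos_le_add fun ε hε => ?_
    have hK : 0 < 1 + h * K := by positivity
    obtain ⟨y, hy, hxy⟩ := (Metric.infDist_lt_iff (x := x) hne).1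
      (lt_add_of_pos_right (Metric.infDist x C) (div_pos hε hK))
    have hmem : y + h • F y ∈ C := by
      have := hconv hy (hmap y hy) (sub_nonneg.2 h1) h0 (by ring)
      rwa [show (1 - h) • y + h • (y + F y) = y + h • F y by module] at this
    calc Metric.infDist (x + h • F x) C ≤ dist (x + h • F x) (y + h • F y) :=
          Metric.infDist_le_dist_of_mem hmem
      _ ≤ dist x y + h * (K * dist x y) := by
          refine (dist_add_add_le _ _ _ _).trans ?_
          rw [dist_smul₀, Real.norm_of_nonneg h0]
          have := hF.dist_le_mul x y
          gcongr
      _ = (1 + h * K) * dist x y := by ring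
      _ ≤ (1 + h * K) * (Metric.infDist x C + ε / (1 + h * K)) := by gcongr
      _ = _ := by field_simp
  -- The Euler estimate bounds the right Dini derivative of the distance to `C` by `K` times that
  -- distance. Since the distance starts at zero, Gronwall keeps it zero.
  have key := le_gronwallBound_of_liminf_deriv_right_le
    (f := fun s => Metric.infDist (u s) C) (f' := fun s => K * Metric.infDist (u s) C)
    (δ := 0) (K := K) (ε := 0) (a := 0) (b := t)
    ((Metric.continuous_infDist_pt C).comp_continuousOn (hu.1.mono fun x hx => hx.1)) ?_ ?_
    (fun x _ => by simp) t ⟨ht, le_rfl⟩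
  · simpa [gronwallBound_ε0_δ0] using key
  · intro s hs r hr
    have hd := hasDerivWithinAt_iff_tendsto_slope.1 (hu.hasDerivWithinAt hF.continuous hs.1)
    refine Eventually.frequently ?_
    rw [Set.Ici_sdiff_left] at hd
    obtain ⟨δ, hδ, hδr⟩ : ∃ δ > 0, K * Metric.infDist (u s) C + δ < r :=
      ⟨(r - K * Metric.infDist (u s) C) / 2, by linarith, by linarith⟩
    filter_upwards [hd.eventually (Metric.ball_mem_nhds _ hδ), self_mem_nhdsWithin,
      Ioo_mem_nhdsGT (lt_add_one s)] with z hz hsz hz1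
    have hzs : 0 < z - s := sub_pos.2 hsz
    have h1 := hstep (u s) (z - s) hzs.le (by linarith [hz1.2])
    have h2 : Metric.infDist (u z) C ≤
        Metric.infDist (u s + (z - s) • F (u s)) C + dist (u z) (u s + (z - s) • F (u s)) :=
      Metric.infDist_le_infDist_add_dist
    have h3 : dist (u z) (u s + (z - s) • F (u s)) = (z - s) * dist (slope u s z) (F (u s)) := by
      have := dist_smul₀ (z - s) (slope u s z) (F (u s))
      rw [Real.norm_of_nonneg hzs.le] at this
      rw [← this, sub_smul_slope, dist_eq_norm, dist_eq_norm, sub_add_eq_sub_sub, vsub_eq_sub]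
    have h4 := mul_lt_mul_of_pos_left hz hzs
    rw [inv_mul_lt_iff₀ hzs]
    have h5 := mul_lt_mul_of_pos_left hδr hzs
    nlinarith
  · rw [hu.apply_zero, Metric.infDist_zero_of_mem hf]

end IsIntegralSolution

end IntegralEquation

/-! ### The Stefan vector field on `L¹` and the truncation at level one -/

instance : IsOrderedModule ℝ (LOne N) :=
  .of_smul_nonneg fun c hc g hg => by
    rw [← Lp.coeFn_nonneg] at hg ⊢
    filter_upwards [hg, Lp.coeFn_smul c g] with x hx h
    rw [h, Pi.smul_apply]
    exact smul_nonneg hc hx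

/-- The vector field `u ↦ J ∗ G(u) - G(u)` on `L¹`. -/
def stefanField (J : Kernel N) {G : ℝ → ℝ} (hG : LipschitzWith 1 G) (hG0 : G 0 = 0)
    (u : LOne N) : LOne N :=
  conv J (hG.compLp hG0 u) - hG.compLp hG0 u

theorem lipschitzWith_stefanField (J : Kernel N) {G : ℝ → ℝ} (hG : LipschitzWith 1 G)
    (hG0 : G 0 = 0) : LipschitzWith 2 (stefanField J hG hG0) := by
  have h1 : LipschitzWith 1 (hG.compLp hG0 : LOne N → LOne N) := hG.lipschitzWith_compLp hG0
  have h2 : LipschitzWith 1 (convCLM J) :=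
    LipschitzWith.of_dist_le_mul fun g h => by
      rw [dist_eq_norm, dist_eq_norm, ← map_sub, NNReal.coe_one, one_mul]
      exact norm_conv_le J _
  refine ((h2.comp h1).sub h1).weaken ?_
  norm_num

theorem stefanField_zero (J : Kernel N) {G : ℝ → ℝ} (hG : LipschitzWith 1 G) (hG0 : G 0 = 0) :
    stefanField J hG hG0 0 = 0 := by
  rw [stefanField, LipschitzWith.compLp_zero, ← convCLM_apply, map_zero, sub_zero]

theorem exists_isSolution (J : Kernel N) {G : ℝ → ℝ} (hG : LipschitzWith 1 G) (hG0 : G 0 = 0)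
    (f : LOne N) : ∃ u, IsSolution J hG hG0 f u :=
  exists_isIntegralSolution (lipschitzWith_stefanField J hG hG0) (stefanField_zero J hG hG0) f

theorem IsSolution.eqOn {J : Kernel N} {G : ℝ → ℝ} {hG : LipschitzWith 1 G} {hG0 : G 0 = 0}
    {f : LOne N} {u u' : ℝ → LOne N} (hu : IsSolution J hG hG0 f u)
    (hu' : IsSolution J hG hG0 f u') {t : ℝ} (ht : 0 ≤ t) : u t = u' t :=
  IsIntegralSolution.eqOn (lipschitzWith_stefanField J hG hG0) hu hu' ht

/-- Two solutions of possibly different equations agree if their nonlinear terms do. -/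
theorem IsSolution.of_compLp_eq {J : Kernel N} {G G' : ℝ → ℝ} {hG : LipschitzWith 1 G}
    {hG0 : G 0 = 0} {hG' : LipschitzWith 1 G'} {hG0' : G' 0 = 0} {f : LOne N} {u : ℝ → LOne N}
    (hu : IsSolution J hG hG0 f u)
    (h : ∀ t, 0 ≤ t → hG.compLp hG0 (u t) = hG'.compLp hG0' (u t)) :
    IsSolution J hG' hG0' f u := by
  refine ⟨hu.1, fun t ht => ?_⟩
  rw [hu.2 t ht]
  congr 1
  refine intervalIntegral.integral_congr fun s hs => ?_
  rw [Set.uIcc_of_le ht] at hs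
  simp only [h s hs.1]

/-- The excess `(u - 1)₊` of an integrable function over the level one. -/
def excess (u : LOne N) : LOne N :=
  lipschitzWith_onePhaseGraph.compLp onePhaseGraph_zero u

theorem coeFn_excess (u : LOne N) : ∀ᵐ x, excess u x = max (u x - 1) 0 :=
  LipschitzWith.coeFn_compLp _ _ _

theorem continuous_excess : Continuous (excess : LOne N → LOne N) :=
  lipschitzWith_onePhaseGraph.continuous_compLp onePhaseGraph_zero

theorem excess_nonneg (u : LOne N) : 0 ≤ excess u := by
  rw [← Lp.coeFn_nonneg]
  filter_upwards [coeFn_excess u] with x hx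
  rw [hx]
  exact le_max_right _ _

theorem coeFn_sub_excess (u : LOne N) : ∀ᵐ x, (u - excess u : LOne N) x = min (u x) 1 := by
  filter_upwards [coeFn_excess u, Lp.coeFn_sub u (excess u)] with x h1 h2
  rw [h2, Pi.sub_apply, h1]
  rcases le_total (u x) 1 with h | h
  · rw [max_eq_right (by linarith), min_eq_left h, sub_zero]
  · rw [max_eq_left (by linarith), min_eq_right h, sub_sub_cancel]

theorem sub_excess_mono {u u' : LOne N} (h : u ≤ u') : u - excess u ≤ u' - excess u' := by
  rw [← Lp.coeFn_le] at h ⊢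
  filter_upwards [coeFn_sub_excess u, coeFn_sub_excess u', h] with x h1 h2 h3
  rw [h1, h2]
  gcongr

theorem excess_sub_excess (u : LOne N) : excess (u - excess u) = 0 := by
  refine Lp.ext ?_
  filter_upwards [coeFn_sub_excess u, coeFn_excess (u - excess u), Lp.coeFn_zero ℝ 1
    (volume : Measure (Space N))] with x h1 h2 h3
  rw [h2, h1, h3, Pi.zero_apply]
  exact max_eq_right (sub_nonpos.2 (min_le_right _ _))

theorem sub_excess_nonneg {u : LOne N} (h : 0 ≤ u) : 0 ≤ u - excess u := by
  rw [← Lp.coeFn_nonneg] at h ⊢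
  filter_upwards [coeFn_sub_excess u, h] with x h1 h2
  rw [h1]
  exact le_min h2 zero_le_one

/-- Expresses vanishing on `B` as lying in the kernel of a bounded operator, so that it passes
through Bochner integrals and `L¹` limits. -/
theorem restrict_eq_zero_iff {B : Set (Space N)} (hB : MeasurableSet B) (g : LOne N) :
    LpToLpRestrictCLM (Space N) ℝ ℝ volume 1 B g = 0 ↔ ∀ᵐ x, x ∈ B → g x = 0 := by
  rw [← ae_restrict_iff' hB, Lp.eq_zero_iff_ae_eq_zero]
  have h := LpToLpRestrictCLM_coeFn ℝ B g
  exact ⟨fun h' => h.symm.trans h', fun h' => h.trans h'⟩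

theorem volume_one_le {U : LOne N} (hU : 0 ≤ U) :
    volume {x | 1 ≤ U x} ≤ ENNReal.ofReal (∫ x, U x) := by
  have h := meas_ge_le_lintegral_div (μ := volume)
    (Lp.aestronglyMeasurable U).aemeasurable.ennreal_ofReal one_ne_zero ENNReal.one_ne_top
  rw [div_one, ← ofReal_integral_eq_lintegral_ofReal U.integrable ((Lp.coeFn_nonneg U).2 hU)] at h
  simpa only [ENNReal.one_le_ofReal] using h

/-- Conservation of mass. Together with Chebyshev's inequality it bounds the measure of the
saturated set `{U ≥ 1}` by `∫ f`, whatever `w` is, once `U = f + J ∗ w - w` is nonnegative. -/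
theorem integral_add_conv_sub (J : Kernel N) (f w : LOne N) :
    ∫ x, (f + conv J w - w : LOne N) x = ∫ x, f x := by
  have h : (f + conv J w - w : LOne N) =ᵐ[volume] fun x => f x + conv J w x - w x := by
    filter_upwards [Lp.coeFn_sub (f + conv J w) w, Lp.coeFn_add f (conv J w)] with x h1 h2
    rw [h1, Pi.sub_apply, h2, Pi.add_apply]
  rw [integral_congr_ae h]
  refine (integral_sub (f.integrable.add (conv J w).integrable) w.integrable).trans ?_
  rw [integral_add' f.integrable (conv J w).integrable, integral_conv, add_sub_cancel_right]

/-! ### Uniqueness for the obstacle problem -/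

/-- Let `p = (w - w')₊`. Where `p > 0` one has `w > w' ≥ 0`, so complementarity forces `U = 1 ≥ U'`,
whence `p ≤ J ∗ p`. As `p` lives on `{U ≥ 1}`, a set of measure at most `∫ f`, the escape estimate
with zero source gives `p = 0`. -/
theorem IsObstacleSolution.le (hN : 1 ≤ N) {J : Kernel N} {f w w' : LOne N}
    (hw : IsObstacleSolution J f w) (hw' : IsObstacleSolution J f w') : w ≤ w' := by
  obtain ⟨h1, h2, h3⟩ := hw
  obtain ⟨h1', h2', -⟩ := hw'
  set U : LOne N := f + conv J w - w with hU
  set U' : LOne N := f + conv J w' - w' with hU'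
  have hU0 : 0 ≤ U := (Lp.coeFn_nonneg U).1 (h2.mono fun x hx => hx.1)
  set p : LOne N := (w - w') ⊔ 0 with hp
  have hdiff : w - w' = conv J (w - w') - (U - U') := by
    have := (convCLM J).map_sub w w'
    simp only [convCLM_apply] at this
    rw [this, hU, hU']
    abel
  have hpc : conv J (w - w') ≤ conv J p := conv_mono J le_sup_left
  have hp0 : 0 ≤ p := le_sup_right
  have hae : ∀ᵐ x, p x ≤ conv J p x ∧ (p x ≠ 0 → 1 ≤ U x) := by
    rw [← Lp.coeFn_le] at hpc
    filter_upwards [h1, h2, h3, h1', h2', hpc, (Lp.coeFn_nonneg _).2 (conv_nonneg J hp0),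
      Lp.coeFn_sup (w - w') 0, Lp.coeFn_zero ℝ 1 (volume : Measure (Space N)),
      Lp.coeFn_sub w w', Lp.coeFn_sub (conv J (w - w')) (U - U'), Lp.coeFn_sub U U']
      with x a1 a2 a3 a4 a5 a6 a7 a8 a9 a10 a11 a12
    rw [← hdiff] at a11
    simp only [Pi.sub_apply, Pi.sup_apply, Pi.zero_apply] at *
    rw [← hp, a9] at a8
    rcases le_or_gt ((w - w' : LOne N) x) 0 with hle | hgt
    · rw [max_eq_right hle] at a8
      rw [a8]
      exact ⟨a7, fun h => absurd rfl h⟩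
    · have hwx : w x ≠ 0 := by
        rw [a10] at hgt
        linarith
      have hU1 : U x = 1 := by
        have := (mul_eq_zero.1 a3).resolve_right hwx
        linarith
      rw [max_eq_left hgt.le] at a8
      rw [a8]
      exact ⟨by linarith, fun _ => hU1.ge⟩
  obtain ⟨C, hC⟩ := exists_norm_le_of_le_conv_add hN J (∫ x, f x)
  have hnorm := hC p 0 hp0 le_rfl
    (by rw [add_zero]; exact (Lp.coeFn_le _ _).1 (hae.mono fun x hx => hx.1))
    (by
      refine (measure_mono_ae (hae.mono fun x hx => hx.2)).trans ((volume_one_le hU0).trans_eq ?_)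
      rw [hU, integral_add_conv_sub])
  rw [norm_zero, mul_zero] at hnorm
  have hpz : p = 0 := norm_le_zero_iff.1 hnorm
  exact sub_nonpos.1 (le_sup_left.trans_eq hpz)

theorem IsObstacleSolution.unique (hN : 1 ≤ N) {J : Kernel N} {f w w' : LOne N}
    (hw : IsObstacleSolution J f w) (hw' : IsObstacleSolution J f w') : w = w' :=
  le_antisymm (hw.le hN hw') (hw'.le hN hw)

theorem proj_eq (hN : 1 ≤ N) {J : Kernel N} {f w : LOne N} (hw : IsObstacleSolution J f w) :
    proj J f = f + conv J w - w := by
  have h : ∃ w, IsObstacleSolution J f w := ⟨w, hw⟩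
  rw [proj, dif_pos h, IsObstacleSolution.unique hN h.choose_spec hw]

/-! ### One-phase solutions: monotone truncations, the Baiocchi variable and the large-time limit -/

namespace IsOnePhaseSolution

variable {J : Kernel N} {f : LOne N} {u : ℝ → LOne N}

theorem isIntegralSolution (hu : IsOnePhaseSolution J f u) :
    IsIntegralSolution
      (stefanField J lipschitzWith_onePhaseGraph onePhaseGraph_zero) f u := hu

/-- The closed convex set `{v ≥ min(f, 1)}` is invariant: a unit Euler step sends `v` to `min(v, 1)
+ J ∗ (v - 1)₊`, and truncating `v ≥ min(f, 1)` at level one preserves that lower bound. -/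
theorem sub_excess_initial_le (hu : IsOnePhaseSolution J f u) {t : ℝ} (ht : 0 ≤ t) :
    f - excess f ≤ u t := by
  refine hu.isIntegralSolution.mem_of_convex (lipschitzWith_stefanField J _ _)
    (C := Set.Ici (f - excess f)) isClosed_Ici (convex_Ici _) (fun v hv => ?_) ?_ ht
  · rw [Set.mem_Ici] at hv ⊢
    show _ ≤ v + (conv J (excess v) - excess v)
    have h1 := sub_excess_mono hv
    rw [excess_sub_excess, sub_zero] at h1
    have h2 := conv_nonneg J (excess_nonneg v)
    calc f - excess f ≤ v - excess v := h1
      _ ≤ (v - excess v) + conv J (excess v) := le_add_of_nonneg_right h2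
      _ = _ := by abel
  · exact sub_le_self f (excess_nonneg f)

theorem sub_excess_le (hu : IsOnePhaseSolution J f u) {s t : ℝ} (hs : 0 ≤ s) (hst : s ≤ t) :
    u s - excess (u s) ≤ u t := by
  have h : IsOnePhaseSolution J (u s) fun t => u (s + t) :=
    hu.isIntegralSolution.shift (lipschitzWith_stefanField J _ _).continuous hs
  simpa using h.sub_excess_initial_le (sub_nonneg.2 hst)

theorem nonneg (hu : IsOnePhaseSolution J f u) (hf : 0 ≤ f) {t : ℝ} (ht : 0 ≤ t) : 0 ≤ u t :=
  (sub_excess_nonneg hf).trans (hu.sub_excess_initial_le ht)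

theorem intervalIntegrable_excess (hu : IsOnePhaseSolution J f u) {a b : ℝ} (ha : 0 ≤ a)
    (hb : 0 ≤ b) : IntervalIntegrable (fun s => excess (u s)) volume a b :=
  hu.isIntegralSolution.intervalIntegrable_comp continuous_excess ha hb

end IsOnePhaseSolution

/-- The Baiocchi variable `∫₀ᵗ (u(s) - 1)₊ ds`. -/
def baiocchi (u : ℝ → LOne N) (t : ℝ) : LOne N := ∫ s in (0 : ℝ)..t, excess (u s)

theorem integral_excess_nonneg (u : ℝ → LOne N) {a b : ℝ} (hab : a ≤ b) :
    0 ≤ ∫ s in a..b, excess (u s) := by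
  rw [intervalIntegral.integral_of_le hab]
  exact integral_nonneg fun s => excess_nonneg (u s)

namespace IsOnePhaseSolution

variable {J : Kernel N} {f : LOne N} {u : ℝ → LOne N}

theorem baiocchi_sub (hu : IsOnePhaseSolution J f u) {a b : ℝ} (ha : 0 ≤ a) (hb : 0 ≤ b) :
    baiocchi u b - baiocchi u a = ∫ s in a..b, excess (u s) :=
  intervalIntegral.integral_interval_sub_left (hu.intervalIntegrable_excess le_rfl hb)
    (hu.intervalIntegrable_excess le_rfl ha)

theorem baiocchi_mono (hu : IsOnePhaseSolution J f u) {a b : ℝ} (ha : 0 ≤ a) (hab : a ≤ b) :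
    baiocchi u a ≤ baiocchi u b := by
  rw [← sub_nonneg, hu.baiocchi_sub ha (ha.trans hab)]
  exact integral_excess_nonneg u hab

theorem eq_add_conv_sub (hu : IsOnePhaseSolution J f u) {t : ℝ} (ht : 0 ≤ t) :
    u t = f + conv J (baiocchi u t) - baiocchi u t := by
  have hi := hu.intervalIntegrable_excess le_rfl ht
  have h1 := (convCLM J).intervalIntegral_comp_comm hi
  rw [hu.2 t ht, add_sub_assoc]
  congr 1
  show ∫ s in (0 : ℝ)..t, (conv J (excess (u s)) - excess (u s)) = _
  rw [intervalIntegral.integral_sub _ hi]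
  · exact congrArg (· - baiocchi u t) h1
  · exact hu.isIntegralSolution.intervalIntegrable_comp
      ((convCLM J).continuous.comp continuous_excess) le_rfl ht

/-- The Baiocchi variable vanishes where the truncations `min(u(s), 1)` stay below some `X < 1`. -/
theorem baiocchi_eq_zero (hu : IsOnePhaseSolution J f u) {X : LOne N} {t : ℝ} (ht : 0 ≤ t)
    (hX : ∀ s, 0 ≤ s → s ≤ t → u s - excess (u s) ≤ X) :
    ∀ᵐ x, X x < 1 → baiocchi u t x = 0 := by
  have hBm : MeasurableSet {x | X x < 1} :=
    (Lp.stronglyMeasurable X).measurable measurableSet_Iio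
  refine (restrict_eq_zero_iff hBm _).1 ?_
  -- Restriction to `{X < 1}` commutes with the time integral. On that set `min(u(s), 1) ≤ X < 1`
  -- forces `u(s) < 1`, so the integrand vanishes.
  rw [baiocchi, ← ContinuousLinearMap.intervalIntegral_comp_comm _
    (hu.intervalIntegrable_excess le_rfl ht)]
  refine (intervalIntegral.integral_congr (g := fun _ => 0) fun s hs => ?_).trans (by simp)
  rw [Set.uIcc_of_le ht] at hs
  refine (restrict_eq_zero_iff hBm _).2 ?_
  have h := hX s hs.1 hs.2
  rw [← Lp.coeFn_le] at h
  filter_upwards [h, coeFn_sub_excess (u s), coeFn_excess (u s)] with x a1 a2 a3 hx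
  rw [a2] at a1
  rw [a3]
  refine max_eq_right (sub_nonpos.2 ?_)
  exact ((min_lt_iff.1 (a1.trans_lt hx)).resolve_right (lt_irrefl 1)).le

theorem exists_norm_baiocchi_le (hN : 1 ≤ N) (hu : IsOnePhaseSolution J f u) (hf : 0 ≤ f) :
    ∃ C : ℝ, ∀ t, 0 ≤ t → ‖baiocchi u t‖ ≤ C := by
  obtain ⟨C, hC⟩ := exists_norm_le_of_le_conv_add hN J (∫ x, f x)
  refine ⟨C * ‖f‖, fun t ht => hC _ _ (integral_excess_nonneg u ht) hf ?_ ?_⟩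
  · have h := hu.nonneg hf ht
    rw [hu.eq_add_conv_sub ht, sub_nonneg, add_comm] at h
    exact h
  -- Taking `X = u t` places the Baiocchi variable on `{u(t) ≥ 1}`, whose measure is at most `∫ f`
  -- for every `t`.
  · have h := hu.baiocchi_eq_zero (X := u t) ht fun s hs hst => hu.sub_excess_le hs hst
    have h' : ∀ᵐ x, baiocchi u t x ≠ 0 → 1 ≤ u t x :=
      h.mono fun x hx hne => not_lt.1 fun hlt => hne (hx hlt)
    refine (measure_mono_ae h').trans ((volume_one_le (hu.nonneg hf ht)).trans_eq ?_)
    rw [hu.eq_add_conv_sub ht, integral_add_conv_sub]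

theorem exists_tendsto_baiocchi (hN : 1 ≤ N) (hu : IsOnePhaseSolution J f u) (hf : 0 ≤ f) :
    ∃ W, Tendsto (baiocchi u) atTop (𝓝 W) := by
  obtain ⟨C, hC⟩ := hu.exists_norm_baiocchi_le hN hf
  -- Freezing negative times makes the family monotone on all of `ℝ`.
  set w : ℝ → LOne N := fun t => baiocchi u (max t 0) with hw
  have hnn (t : ℝ) : 0 ≤ w t := integral_excess_nonneg u (le_max_right _ _)
  have hmono : Monotone w := fun s t hst =>
    hu.baiocchi_mono (le_max_right _ _) (max_le_max_right 0 hst)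
  have hnorm {s t : ℝ} (hst : s ≤ t) : ‖w t - w s‖ = ‖w t‖ - ‖w s‖ := by
    rw [norm_eq_integral (sub_nonneg.2 (hmono hst)), norm_eq_integral (hnn s),
      norm_eq_integral (hnn t), integral_congr_ae (Lp.coeFn_sub (w t) (w s))]
    exact integral_sub (w t).integrable (w s).integrable
  -- The `L¹` norm is additive on nonnegative functions, so along a monotone nonnegative family
  -- distances are differences of norms. Convergence of the bounded norms thus makes the family
  -- Cauchy.
  have hdist (s t : ℝ) : dist (w s) (w t) = dist ‖w s‖ ‖w t‖ := by
    rcases le_total s t with h | h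
    · rw [dist_comm, dist_eq_norm, hnorm h, dist_comm, Real.dist_eq, abs_of_nonneg]
      rw [← hnorm h]
      exact norm_nonneg _
    · rw [dist_eq_norm, hnorm h, Real.dist_eq, abs_of_nonneg]
      rw [← hnorm h]
      exact norm_nonneg _
  have hnmono : Monotone fun t => ‖w t‖ := fun s t hst => by
    have := norm_nonneg (w t - w s)
    rw [hnorm hst] at this
    exact sub_nonneg.1 this
  have hlim := tendsto_atTop_ciSup hnmono
    ⟨C, by rintro _ ⟨t, rfl⟩; exact hC _ (le_max_right _ _)⟩
  have hcauchy : CauchySeq w := by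
    have := hlim.cauchySeq
    rw [Metric.cauchySeq_iff] at this ⊢
    simpa only [hdist] using this
  obtain ⟨W, hW⟩ := cauchySeq_tendsto_of_complete hcauchy
  refine ⟨W, hW.congr' ?_⟩
  filter_upwards [eventually_ge_atTop 0] with t ht
  rw [hw]
  simp only [max_eq_left ht]

theorem exists_isObstacleSolution (hN : 1 ≤ N) (hu : IsOnePhaseSolution J f u) (hf : 0 ≤ f) :
    ∃ W, IsObstacleSolution J f W ∧ Tendsto u atTop (𝓝 (f + conv J W - W)) := by
  obtain ⟨W, hW⟩ := hu.exists_tendsto_baiocchi hN hf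
  set U : LOne N := f + conv J W - W with hU
  have hlim : Tendsto u atTop (𝓝 U) := by
    have h : Tendsto (fun t => f + conv J (baiocchi u t) - baiocchi u t) atTop (𝓝 U) :=
      (tendsto_const_nhds.add (((convCLM J).continuous.tendsto W).comp hW)).sub hW
    refine h.congr' ?_
    filter_upwards [eventually_ge_atTop 0] with t ht
    exact (hu.eq_add_conv_sub ht).symm
  have hexc : Tendsto (fun t => excess (u t)) atTop (𝓝 (excess U)) :=
    (continuous_excess.tendsto U).comp hlim
  -- The increment of the Baiocchi variable over `[t, t + 1]` tends to zero since that variable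
  -- converges. It is also an average of `(u(s) - 1)₊` over late times, so it tends to `(U - 1)₊`.
  have hexc0 : excess U = 0 := by
    have h1 : Tendsto (fun t => baiocchi u (t + 1) - baiocchi u t) atTop (𝓝 (W - W)) :=
      (hW.comp (tendsto_atTop_add_const_right _ 1 tendsto_id)).sub hW
    have h2 : Tendsto (fun t => baiocchi u (t + 1) - baiocchi u t) atTop (𝓝 (excess U)) := by
      rw [Metric.tendsto_atTop] at hexc ⊢
      intro ε hε
      obtain ⟨T, hT⟩ := hexc (ε / 2) (half_pos hε)
      refine ⟨max T 0, fun t ht => ?_⟩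
      have ht0 : 0 ≤ t := (le_max_right _ _).trans ht
      rw [hu.baiocchi_sub ht0 (by linarith), dist_eq_norm]
      have hconst : excess U = ∫ _ in t..(t + 1), excess U := by simp
      rw [hconst, ← intervalIntegral.integral_sub
        (hu.intervalIntegrable_excess ht0 (by linarith)) intervalIntegrable_const]
      refine (intervalIntegral.norm_integral_le_of_norm_le_const (C := ε / 2)
        fun s hs => ?_).trans_lt (by simpa using hε)
      rw [Set.uIoc_of_le (by linarith)] at hs
      rw [← dist_eq_norm]
      exact (hT s (((le_max_left _ _).trans ht).trans hs.1.le)).le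
    rw [sub_self] at h1
    exact tendsto_nhds_unique h2 h1
  have hW0 : 0 ≤ W := by
    refine ge_of_tendsto hW ?_
    filter_upwards [eventually_ge_atTop 0] with t ht
    exact integral_excess_nonneg u ht
  have hU0 : 0 ≤ U := by
    refine ge_of_tendsto hlim ?_
    filter_upwards [eventually_ge_atTop 0] with t ht
    exact hu.nonneg hf ht
  have hU1 : ∀ᵐ x, U x ≤ 1 := by
    have h := coeFn_excess U
    rw [hexc0] at h
    filter_upwards [h, Lp.coeFn_zero ℝ 1 (volume : Measure (Space N))] with x a1 a2
    rw [a2, Pi.zero_apply] at a1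
    linarith [le_max_left (U x - 1) 0]
  have hXU (s : ℝ) (hs : 0 ≤ s) : u s - excess (u s) ≤ U := by
    refine ge_of_tendsto hlim ?_
    filter_upwards [eventually_ge_atTop s] with t ht
    exact hu.sub_excess_le hs ht
  -- Complementarity: with the limit `U` as the bound on the truncations, every `w(t)` vanishes on
  -- the fixed set `{U < 1}`, and so does its limit.
  have hzero : ∀ᵐ x, U x < 1 → W x = 0 := by
    have hBm : MeasurableSet {x | U x < 1} :=
      (Lp.stronglyMeasurable U).measurable measurableSet_Iio
    refine (restrict_eq_zero_iff hBm W).1 (tendsto_nhds_unique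
      ((ContinuousLinearMap.continuous _).tendsto W |>.comp hW)
      ((tendsto_const_nhds (x := 0)).congr' ?_))
    filter_upwards [eventually_ge_atTop 0] with t ht
    exact ((restrict_eq_zero_iff hBm _).2
      (hu.baiocchi_eq_zero (X := U) ht fun s hs _ => hXU s hs)).symm
  refine ⟨W, ⟨(Lp.coeFn_nonneg W).2 hW0, ?_, ?_⟩, hlim⟩
  · filter_upwards [(Lp.coeFn_nonneg U).2 hU0, hU1] with x a1 a2
    exact ⟨a1, a2⟩
  · filter_upwards [hU1, hzero] with x a1 a2
    rcases a1.lt_or_eq with h | h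
    · rw [a2 h, mul_zero]
    · rw [h, sub_self, zero_mul]

theorem tendsto_proj (hN : 1 ≤ N) (hu : IsOnePhaseSolution J f u) (hf : 0 ≤ f) :
    Tendsto u atTop (𝓝 (proj J f)) := by
  obtain ⟨W, hW, hlim⟩ := hu.exists_isObstacleSolution hN hf
  rwa [proj_eq hN hW]

theorem sub_excess_le_proj (hN : 1 ≤ N) (hu : IsOnePhaseSolution J f u) (hf : 0 ≤ f) {s : ℝ}
    (hs : 0 ≤ s) : u s - excess (u s) ≤ proj J f := by
  refine ge_of_tendsto (hu.tendsto_proj hN hf) ?_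
  filter_upwards [eventually_ge_atTop s] with t ht
  exact hu.sub_excess_le hs ht

end IsOnePhaseSolution

/-! ### Supports, and the passage from one phase to two -/

/-- Locally this is the fundamental lemma of the calculus of variations; a locally null set in `ℝ^N`
is null. -/
theorem ae_eq_zero_of_notMem_distSupport (g : LOne N) : ∀ᵐ x, x ∉ distSupport g → g x = 0 := by
  rw [ae_iff]
  refine measure_null_of_locally_null _ fun x hx => ?_
  have hx' : x ∉ distSupport g := fun h => hx fun h' => absurd h h'
  obtain ⟨U, hU, hUo, hxU⟩ := (Distribution.notMem_dsupport_iff x).1 hx'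
  refine ⟨{y | ¬(y ∈ U → g y = 0)}, ?_, ?_⟩
  · filter_upwards [mem_nhdsWithin_of_mem_nhds (hUo.mem_nhds hxU), self_mem_nhdsWithin]
      with y hyU hy h
    exact hy fun _ => h hyU
  · rw [← ae_iff]
    refine hUo.ae_eq_zero_of_integral_contDiff_smul_eq_zero
      (g.integrable.locallyIntegrable.locallyIntegrableOn U) fun φ hφ hφc hφU => ?_
    have h := hU (⟨φ, hφ, hφc, Set.subset_univ _⟩ :
      TestFunction (⊤ : TopologicalSpace.Opens (Space N)) ℝ ⊤) hφU
    rw [← h]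
    refine integral_congr_ae (Eventually.of_forall fun y => ?_)
    exact mul_comm _ _

theorem disjoint_of_setDist_pos {A B : Set (Space N)} (h : 0 < setDist A B) : Disjoint A B := by
  rw [Set.disjoint_left]
  intro x hA hB
  have : setDist A B ≤ edist x x := (iInf₂_le x hA).trans (iInf₂_le x hB)
  rw [edist_self] at this
  exact h.not_ge this

theorem lp_posPart_nonneg (f : LOne N) : 0 ≤ Lp.posPart f := by
  rw [← Lp.coeFn_nonneg]
  filter_upwards [Lp.coeFn_posPart f] with x hx
  rw [hx]
  exact le_max_right _ _

theorem lp_negPart_nonneg (f : LOne N) : 0 ≤ Lp.negPart f := by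
  rw [← Lp.coeFn_nonneg]
  filter_upwards [Lp.coeFn_negPart_eq_max f] with x hx
  rw [hx]
  exact le_max_right _ _

theorem lp_posPart_sub_negPart (f : LOne N) : Lp.posPart f - Lp.negPart f = f := by
  refine Lp.ext ?_
  filter_upwards [Lp.coeFn_sub (Lp.posPart f) (Lp.negPart f), Lp.coeFn_posPart f,
    Lp.coeFn_negPart_eq_max f] with x h1 h2 h3
  rw [h1, Pi.sub_apply, h2, h3]
  exact posPart_sub_negPart (f x)

theorem twoPhase_compLp_of_nonneg {v : LOne N} (hv : 0 ≤ v) :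
    lipschitzWith_twoPhaseGraph.compLp twoPhaseGraph_zero v = excess v := by
  rw [← Lp.coeFn_nonneg] at hv
  refine Lp.ext ?_
  filter_upwards [lipschitzWith_twoPhaseGraph.coeFn_compLp twoPhaseGraph_zero v,
    coeFn_excess v, hv] with x h1 h2 h3
  rw [h1, h2, Function.comp_apply, twoPhaseGraph_eq, max_eq_right (b := 0) (a := -v x - 1),
    sub_zero]
  have : 0 ≤ v x := h3
  linarith

theorem IsOnePhaseSolution.isTwoPhaseSolution {J : Kernel N} {f : LOne N} {u : ℝ → LOne N}
    (hu : IsOnePhaseSolution J f u) (hf : 0 ≤ f) : IsTwoPhaseSolution J f u :=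
  IsSolution.of_compLp_eq hu fun _ ht => (twoPhase_compLp_of_nonneg (hu.nonneg hf ht)).symm

theorem IsTwoPhaseSolution.isOnePhaseSolution {J : Kernel N} {f : LOne N} {u : ℝ → LOne N}
    (hu : IsTwoPhaseSolution J f u) (hf : 0 ≤ f) : IsOnePhaseSolution J f u := by
  obtain ⟨U, hU⟩ := exists_isSolution J lipschitzWith_onePhaseGraph onePhaseGraph_zero f
  have hU' : IsOnePhaseSolution J f U := hU
  refine IsSolution.of_compLp_eq hu fun t ht => ?_
  -- The sign of `u` is not known directly. The one-phase solution `U` with the same data is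
  -- nonnegative, hence also a two-phase solution, and uniqueness transfers its sign to `u`.
  rw [IsSolution.eqOn hu (hU'.isTwoPhaseSolution hf) ht]
  exact twoPhase_compLp_of_nonneg (hU'.nonneg hf ht)

theorem existsUnique_isObstacleSolution (hN : 1 ≤ N) (J : Kernel N) {f : LOne N} (hf : 0 ≤ f) :
    ∃! w, IsObstacleSolution J f w := by
  obtain ⟨u, hu⟩ := exists_isSolution J lipschitzWith_onePhaseGraph onePhaseGraph_zero f
  obtain ⟨W, hW, -⟩ := IsOnePhaseSolution.exists_isObstacleSolution hN hu hf
  exact ⟨W, hW, fun w hw => hw.unique hN hW⟩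

theorem twoPhaseGraph_sub {a b : ℝ} (ha : 0 ≤ a) (hb : 0 ≤ b) (h : a ≤ 1 ∨ b = 0)
    (h' : b ≤ 1 ∨ a = 0) : twoPhaseGraph (a - b) = max (a - 1) 0 - max (b - 1) 0 := by
  rw [twoPhaseGraph_eq]
  grind

/-- If the limits of two nonnegative one-phase solutions have disjoint supports, the nonlinear
term splits along their difference. -/
theorem twoPhase_compLp_sub (hN : 1 ≤ N) {J : Kernel N} {f g : LOne N} {u v : ℝ → LOne N}
    (hf : 0 ≤ f) (hg : 0 ≤ g) (hu : IsOnePhaseSolution J f u) (hv : IsOnePhaseSolution J g v)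
    (hdisj : Disjoint (distSupport (proj J f)) (distSupport (proj J g))) {t : ℝ} (ht : 0 ≤ t) :
    lipschitzWith_twoPhaseGraph.compLp twoPhaseGraph_zero (u t - v t) =
      excess (u t) - excess (v t) := by
  refine Lp.ext ?_
  filter_upwards [lipschitzWith_twoPhaseGraph.coeFn_compLp twoPhaseGraph_zero (u t - v t),
    Lp.coeFn_sub (u t) (v t), Lp.coeFn_sub (excess (u t)) (excess (v t)),
    coeFn_excess (u t), coeFn_excess (v t),
    (Lp.coeFn_nonneg _).2 (hu.nonneg hf ht), (Lp.coeFn_nonneg _).2 (hv.nonneg hg ht),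
    (Lp.coeFn_le _ _).2 (hu.sub_excess_le_proj hN hf ht),
    (Lp.coeFn_le _ _).2 (hv.sub_excess_le_proj hN hg ht),
    coeFn_sub_excess (u t), coeFn_sub_excess (v t),
    ae_eq_zero_of_notMem_distSupport (proj J f), ae_eq_zero_of_notMem_distSupport (proj J g)]
    with x a1 a2 a3 a4 a5 a6 a7 a8 a9 a10 a11 a12 a13
  rw [Pi.zero_apply] at a6 a7
  rw [a10] at a8
  rw [a11] at a9
  rw [a1, Function.comp_apply, a2, a3, Pi.sub_apply, Pi.sub_apply, a4, a5]
  -- Off the support of its limit, a solution satisfies `min(u, 1) ≤ 0`, hence `u = 0` by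
  -- nonnegativity. Disjointness puts each point off at least one of the two supports.
  have key : u t x = 0 ∨ v t x = 0 := by
    by_cases hx : x ∈ distSupport (proj J f)
    · right
      rw [a13 (Set.disjoint_left.1 hdisj hx)] at a9
      exact le_antisymm ((min_le_iff.1 a9).resolve_right (by norm_num)) a7
    · left
      rw [a12 hx] at a8
      exact le_antisymm ((min_le_iff.1 a8).resolve_right (by norm_num)) a6
  refine twoPhaseGraph_sub a6 a7 ?_ ?_
  · exact key.imp_left fun h => h.trans_le zero_le_one
  · exact key.symm.imp_left fun h => h.trans_le zero_le_one

theorem isTwoPhaseSolution_sub (hN : 1 ≤ N) {J : Kernel N} {f g : LOne N} {u v : ℝ → LOne N}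
    (hf : 0 ≤ f) (hg : 0 ≤ g) (hu : IsOnePhaseSolution J f u) (hv : IsOnePhaseSolution J g v)
    (hdisj : Disjoint (distSupport (proj J f)) (distSupport (proj J g))) :
    IsTwoPhaseSolution J (f - g) fun t => u t - v t := by
  have hF := (lipschitzWith_stefanField J lipschitzWith_onePhaseGraph onePhaseGraph_zero).continuous
  refine ⟨hu.1.sub hv.1, fun t ht => ?_⟩
  have h : ∫ s in (0 : ℝ)..t,
      (conv J (lipschitzWith_twoPhaseGraph.compLp twoPhaseGraph_zero (u s - v s)) -
        lipschitzWith_twoPhaseGraph.compLp twoPhaseGraph_zero (u s - v s)) =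
      ∫ s in (0 : ℝ)..t, ((conv J (excess (u s)) - excess (u s)) -
        (conv J (excess (v s)) - excess (v s))) := by
    refine intervalIntegral.integral_congr fun s hs => ?_
    rw [Set.uIcc_of_le ht] at hs
    have hmap := (convCLM J).map_sub (excess (u s)) (excess (v s))
    simp only [convCLM_apply] at hmap
    simp only [twoPhase_compLp_sub hN hf hg hu hv hdisj hs.1, hmap]
    abel
  have hs := intervalIntegral.integral_sub
    (hu.isIntegralSolution.intervalIntegrable_comp hF le_rfl ht)
    (hv.isIntegralSolution.intervalIntegrable_comp hF le_rfl ht)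
  rw [h]
  refine Eq.trans ?_ (congrArg (f - g + ·) hs.symm)
  show u t - v t = _
  rw [hu.2 t ht, hv.2 t ht, add_sub_add_comm]
  rfl

end NonlocalStefan

end

open NonlocalStefan
theorem mainTheorem3 {N : ℕ} (hN : 1 ≤ N) (J : Kernel N) (f : LOne N)
    (hlow : N ≤ 2 → J.RadiallyNonincreasing ∧
      ∃ g₁ g₂ : Space N → ℝ, IsRadialMajorant g₁ ∧ IsRadialMajorant g₂ ∧
        (∀ᵐ x, Lp.posPart f x ≤ g₁ x) ∧ (∀ᵐ x, Lp.negPart f x ≤ g₂ x)) :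
    -- the obstacle problems defining the projections of the two parts are uniquely solvable
    (∃! w, IsObstacleSolution J (Lp.posPart f) w) ∧
    (∃! w, IsObstacleSolution J (Lp.negPart f) w) ∧
    (ENNReal.ofReal (2 * J.radius) <
      setDist (distSupport (proj J (Lp.posPart f))) (distSupport (proj J (Lp.negPart f))) →
    -- the three evolution problems are solvable
    (∃ u, IsTwoPhaseSolution J f u) ∧
    (∃ Up, IsTwoPhaseSolution J (Lp.posPart f) Up) ∧
    (∃ Um, IsTwoPhaseSolution J (Lp.negPart f) Um) ∧
    ∀ u Up Um : ℝ → LOne N, IsTwoPhaseSolution J f u →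
      IsTwoPhaseSolution J (Lp.posPart f) Up → IsTwoPhaseSolution J (Lp.negPart f) Um →
      IsOnePhaseSolution J (Lp.posPart f) Up ∧ IsOnePhaseSolution J (Lp.negPart f) Um ∧
      (∀ t : ℝ, 0 ≤ t → u t = Up t - Um t) ∧
      Tendsto Up atTop (𝓝 (proj J (Lp.posPart f))) ∧
      Tendsto Um atTop (𝓝 (proj J (Lp.negPart f))) ∧
      Tendsto u atTop (𝓝 (proj J (Lp.posPart f) - proj J (Lp.negPart f)))) := by
  have hp := lp_posPart_nonneg f
  have hm := lp_negPart_nonneg f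
  refine ⟨existsUnique_isObstacleSolution hN J hp, existsUnique_isObstacleSolution hN J hm,
    fun hdist => ⟨exists_isSolution J _ _ _, exists_isSolution J _ _ _, exists_isSolution J _ _ _,
      fun u Up Um hu hUp hUm => ?_⟩⟩
  have hUp1 := hUp.isOnePhaseSolution hp
  have hUm1 := hUm.isOnePhaseSolution hm
  -- The separation hypothesis makes the distance between the supports positive, hence the supports
  -- disjoint.
  have hsub := isTwoPhaseSolution_sub hN hp hm hUp1 hUm1
    (disjoint_of_setDist_pos (bot_le.trans_lt hdist))
  rw [lp_posPart_sub_negPart f] at hsub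
  have heq (t : ℝ) (ht : 0 ≤ t) : u t = Up t - Um t := IsSolution.eqOn hu hsub ht
  have hlimp := hUp1.tendsto_proj hN hp
  have hlimm := hUm1.tendsto_proj hN hm
  refine ⟨hUp1, hUm1, heq, hlimp, hlimm, (hlimp.sub hlimm).congr' ?_⟩
  filter_upwards [eventually_ge_atTop 0] with t ht
  exact (heq t ht).symm
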